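/- For a finite poset $P$, let $|P|$ be the geometric realization of its order complex, the simplicial complex whose simplices are the nonempty chains of $P$; two finite posets are called homotopy equivalent if their realizations are, and $P$ is called contractible if $|P|$ is contractible. Let $X$ be a finite meet-semilattice, let $g$ be an automorphism of $X$, and let $x\in X$ (not necessarily fixed by $g$). Let $X^g=\{z\in X : g(z)=z\}$ be the fixed-point subposet, let ${}^gX=\{y\in X : y\le z \text{ for some } z\in X^g\}$ be its downward closure in $X$, and put $X^g_{>x}=\{z\in X^g : z>x\}$ and ${}^gX_{>x}=\{y\in {}^gX : y>x\}$. Then the posets $X^g_{>x}$ and ${}^gX_{>x}$ are homotopy equivalent; more precisely, the inclusion $i: X^g_{>x}\hookrightarrow {}^gX_{>x}$ induces a homotopy equivalence $|X^g_{>x}|\to|{}^gX_{>x}|$. (If $X^g_{>x}$ is empty, then so is ${}^gX_{>x}$.) Moreover, for every $y\in{}^gX_{>x}$ the fibre $y\backslash i=\{z\in X^g_{>x} : z\ge y\}$ is nonempty and closed under binary meets in $X$, has a least element, and is contractible. -/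

import Mathlib

/-- The order complex of a poset `P`: its faces are the nonempty finite chains of `P`. -/
def orderComplex (P : Type*) [PartialOrder P] : AbstractSimplicialComplex P where
  faces := {s | s.Nonempty ∧ IsChain (· ≤ ·) (s : Set P)}
  isRelLowerSet_faces := fun _ hs =>
    ⟨hs.1, fun _ hts ht => ⟨ht, hs.2.mono (Finset.coe_subset.mpr hts)⟩⟩
  singleton_mem := fun v => ⟨Finset.singleton_nonempty v, by simp⟩

/-- The geometric realization of an abstract simplicial complex on a finite vertex set `V`, in
barycentric coordinates: nonnegative weights on the vertices, of total weight one, whose support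
is a face. -/
def AbstractSimplicialComplex.realization {V : Type*} [Finite V]
    (K : AbstractSimplicialComplex V) : Set (V → ℝ) :=
  {w | (∀ v, 0 ≤ w v) ∧ ∑ᶠ v, w v = 1 ∧ ∃ s ∈ K.faces, (s : Set V) = Function.support w}

/-- The topological space attached to a finite poset: the geometric realization of its order
complex, with the topology of a subspace of `P → ℝ`. -/
abbrev PosetSpace (P : Type*) [PartialOrder P] [Finite P] : Type _ :=
  ↥(orderComplex P).realization

theorem linearMap_mem_realization {P Q : Type*} [PartialOrder P] [Finite P] [PartialOrder Q]
    [Finite Q] (f : P →o Q) {w : P → ℝ} (hw : w ∈ (orderComplex P).realization) :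
    FunOnFinite.linearMap ℝ ℝ f w ∈ (orderComplex Q).realization := by
  classical
  have := Fintype.ofFinite P
  have := Fintype.ofFinite Q
  obtain ⟨h0, h1, s, hs, hsw⟩ := hw
  refine ⟨fun q => ?_, ?_, s.image f, ⟨hs.1.image f, ?_⟩, ?_⟩
  · rw [FunOnFinite.linearMap_apply_apply]
    exact Finset.sum_nonneg fun p _ => h0 p
  · rw [finsum_eq_sum_of_fintype] at h1 ⊢
    simp only [FunOnFinite.linearMap_apply_apply, ← h1]
    exact Finset.sum_fiberwise Finset.univ f w
  · rw [Finset.coe_image]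
    rintro _ ⟨a, ha, rfl⟩ _ ⟨b, hb, rfl⟩ _
    exact (hs.2.total ha hb).imp (fun h => f.monotone h) fun h => f.monotone h
  · ext q
    rw [Finset.coe_image, hsw, Function.mem_support, FunOnFinite.linearMap_apply_apply, ne_eq,
      Finset.sum_eq_zero_iff_of_nonneg fun p _ => h0 p]
    simp [and_comm]

/-- The continuous map of realizations induced by an order-preserving map `f`: it is affine on each
simplex and sends the vertex `p` to the vertex `f p`, so that the weight of `q` in the image is the
sum of the weights of the `p` with `f p = q`. -/
noncomputable def PosetSpace.map {P Q : Type*} [PartialOrder P] [Finite P] [PartialOrder Q]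
    [Finite Q] (f : P →o Q) : C(PosetSpace P, PosetSpace Q) where
  toFun w := ⟨FunOnFinite.linearMap ℝ ℝ f w.1, linearMap_mem_realization f w.2⟩
  continuous_toFun :=
    ((FunOnFinite.continuous_linearMap ℝ ℝ f).comp continuous_subtype_val).subtype_mk _

section
variable {X : Type*} [SemilatticeInf X]

/-- The set of fixed points of `g` that are strictly above `x`. -/
def fixedAbove (g : X ≃o X) (x : X) : Set X :=
  {z | g z = z ∧ x < z}

/-- The set of elements strictly above `x` in the downward closure of the fixed points of `g`. -/
def lowerFixedAbove (g : X ≃o X) (x : X) : Set X :=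
  {y | y ∈ lowerClosure {z | g z = z} ∧ x < y}

theorem fixedAbove_subset_lowerFixedAbove (g : X ≃o X) (x : X) :
    fixedAbove g x ⊆ lowerFixedAbove g x :=
  fun _ hz => ⟨subset_lowerClosure hz.1, hz.2⟩

/-- The inclusion of the fixed points above `x` into the elements above `x` of the downward
closure of the fixed points, as an order-preserving map. -/
def fixedAboveIncl (g : X ≃o X) (x : X) : fixedAbove g x →o lowerFixedAbove g x where
  toFun := Set.inclusion (fixedAbove_subset_lowerFixedAbove g x)
  monotone' := fun _ _ h => h

/-- The fibre over `y` of the inclusion: the fixed points strictly above `x` that are at least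
`y`. -/
def fixedAboveFibre (g : X ≃o X) (x y : X) : Set X :=
  {z | z ∈ fixedAbove g x ∧ y ≤ z}

end

/-! An automorphism preserves meets, so the fixed points above a given `y` are closed under meets;
by finiteness there is a least one, `r y`. The map `r` is monotone, satisfies `y ≤ r y`, and fixes
every fixed point, so it is a closure operator retracting the large poset onto the small one.
Comparable monotone maps have homotopic realizations (`homotopic_map_of_le`), which makes `r` a
homotopy inverse of the inclusion and makes any poset with a least element contractible. -/

theorem orderComplex_realization_mem_iff {P : Type*} [PartialOrder P] [Finite P] {w : P → ℝ} :
    w ∈ (orderComplex P).realization ↔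
      (∀ p, 0 ≤ w p) ∧ ∑ᶠ p, w p = 1 ∧ IsChain (· ≤ ·) (Function.support w) := by
  constructor
  · rintro ⟨h0, h1, s, hs, hsw⟩
    exact ⟨h0, h1, hsw ▸ hs.2⟩
  · rintro ⟨h0, h1, h⟩
    refine ⟨h0, h1, (Set.toFinite (Function.support w)).toFinset, ⟨?_, ?_⟩, ?_⟩
    · rw [Set.Finite.toFinset_nonempty, Function.support_nonempty_iff]
      rintro rfl
      simp at h1
    · simpa using h
    · simp

namespace PosetSpace

variable {P Q R : Type*} [PartialOrder P] [Finite P] [PartialOrder Q] [Finite Q]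
  [PartialOrder R] [Finite R]

theorem map_id : map (OrderHom.id : P →o P) = ContinuousMap.id _ := by
  ext1 w
  apply Subtype.ext
  change FunOnFinite.linearMap ℝ ℝ (id : P → P) w.1 = w.1
  rw [FunOnFinite.linearMap_id]
  rfl

theorem map_comp (f : Q →o R) (h : P →o Q) : map (f.comp h) = (map f).comp (map h) := by
  ext1 w
  apply Subtype.ext
  change FunOnFinite.linearMap ℝ ℝ (f ∘ h) w.1 =
    FunOnFinite.linearMap ℝ ℝ f (FunOnFinite.linearMap ℝ ℝ h w.1)
  rw [FunOnFinite.linearMap_comp]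
  rfl

theorem support_map_subset (f : P →o Q) (w : PosetSpace P) :
    Function.support (map f w).1 ⊆ f '' Function.support w.1 := by
  classical
  have := Fintype.ofFinite P
  intro q hq
  change FunOnFinite.linearMap ℝ ℝ f w.1 q ≠ 0 at hq
  rw [FunOnFinite.linearMap_apply_apply] at hq
  obtain ⟨p, hp, hpw⟩ := Finset.exists_ne_zero_of_sum_ne_zero hq
  exact ⟨p, hpw, (Finset.mem_filter.mp hp).2⟩

/-- A straight-line homotopy between maps sending each chain into a common chain. -/
theorem homotopic_map_of_contiguous {f h : P →o Q}
    (H : ∀ s : Set P, IsChain (· ≤ ·) s → IsChain (· ≤ ·) (f '' s ∪ h '' s)) :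
    (map f).Homotopic (map h) := by
  have key (t : unitInterval) (w : PosetSpace P) :
      (1 - (t : ℝ)) • (map f w).1 + (t : ℝ) • (map h w).1 ∈ (orderComplex Q).realization := by
    obtain ⟨f0, f1, -⟩ := orderComplex_realization_mem_iff.mp (map f w).2
    obtain ⟨h0, h1, -⟩ := orderComplex_realization_mem_iff.mp (map h w).2
    refine orderComplex_realization_mem_iff.mpr ⟨fun q => ?_, ?_, ?_⟩
    · exact add_nonneg (mul_nonneg (sub_nonneg.mpr t.2.2) (f0 q)) (mul_nonneg t.2.1 (h0 q))
    · have := Fintype.ofFinite Q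
      rw [finsum_eq_sum_of_fintype] at f1 h1 ⊢
      simp only [Pi.add_apply, Pi.smul_apply, smul_eq_mul, Finset.sum_add_distrib,
        ← Finset.mul_sum, f1, h1]
      ring
    · refine (H _ (orderComplex_realization_mem_iff.mp w.2).2.2).mono ?_
      refine (Function.support_add _ _).trans (Set.union_subset_union ?_ ?_)
      · exact (Function.support_const_smul_subset _ _).trans (support_map_subset f w)
      · exact (Function.support_const_smul_subset _ _).trans (support_map_subset h w)
  refine ⟨⟨⟨fun tw => ⟨_, key tw.1 tw.2⟩, ?_⟩, fun w => ?_, fun w => ?_⟩⟩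
  · exact Continuous.subtype_mk (by fun_prop) _
  · exact Subtype.ext (by simp)
  · exact Subtype.ext (by simp)

/-- Pointwise comparable monotone maps induce homotopic maps of realizations. -/
theorem homotopic_map_of_le {f h : P →o Q} (hfh : f ≤ h) : (map f).Homotopic (map h) := by
  classical
  -- A single straight-line homotopy can fail: for `a < b` the values `f b` and `h a` may be
  -- incomparable. So `f` is turned into `h` one point at a time.
  induction hn : {p | f p ≠ h p}.ncard using Nat.strong_induction_on generalizing f with
  | _ n ih =>
  obtain hD | hD := {p | f p ≠ h p}.eq_empty_or_nonempty
  · have : f = h := by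
      ext p
      by_contra hp
      exact (hD ▸ hp : p ∈ (∅ : Set P))
    rw [this]
  -- Maximality makes `f` and `h` agree strictly above `p`, so raising `f p` to `h p` keeps the map
  -- monotone.
  obtain ⟨p, hp⟩ := (Set.toFinite {p | f p ≠ h p}).exists_maximal hD
  have hmax (b : P) (hb : p < b) : f b = h b := by
    by_contra hne
    exact hb.not_ge (hp.2 hne hb.le)
  let f' : P →o Q :=
    { toFun := Function.update f p (h p)
      monotone' := by
        intro a b hab
        rcases eq_or_ne a p with rfl | ha <;> rcases eq_or_ne b a with rfl | hba
        · rfl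
        · simp only [Function.update_self, Function.update_of_ne hba]
          rw [hmax b (lt_of_le_of_ne hab hba.symm)]
          exact h.monotone hab
        · rfl
        · rcases eq_or_ne b p with rfl | hb
          · simp only [Function.update_self, Function.update_of_ne ha]
            exact (f.monotone hab).trans (hfh b)
          · simp only [Function.update_of_ne ha, Function.update_of_ne hb]
            exact f.monotone hab }
  have hf'p : f' p = h p := Function.update_self p (h p) f
  have hf' (a : P) (ha : a ≠ p) : f' a = f a := Function.update_of_ne ha (h p) f
  have hle : f ≤ f' := fun a => by
    rcases eq_or_ne a p with rfl | ha
    · exact hf'p ▸ hfh a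
    · exact (hf' a ha).ge
  have hle' : f' ≤ h := fun a => by
    rcases eq_or_ne a p with rfl | ha
    · exact hf'p.le
    · exact (hf' a ha) ▸ hfh a
  refine (homotopic_map_of_contiguous ?_).trans (ih _ ?_ hle' rfl)
  · intro s hs
    -- Since `f` and `f'` differ only at `p`, for `b ≤ a` the comparison can be made within `f` or
    -- within `f'`, unless `a = b = p`, where `f ≤ f'` decides.
    have cross {a b : P} (ha : a ∈ s) (hb : b ∈ s) : f a ≤ f' b ∨ f' b ≤ f a := by
      rcases hs.total ha hb with hab | hba
      · exact .inl ((f.monotone hab).trans (hle b))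
      · rcases eq_or_ne b p with rfl | hbp
        · rcases eq_or_ne a b with rfl | hne
          · exact .inl (hle a)
          · exact .inr (hf' a hne ▸ f'.monotone hba)
        · exact .inr (hf' b hbp ▸ f.monotone hba)
    rintro _ (⟨a, ha, rfl⟩ | ⟨a, ha, rfl⟩) _ (⟨b, hb, rfl⟩ | ⟨b, hb, rfl⟩) _
    · exact (hs.total ha hb).imp (fun h => f.monotone h) fun h => f.monotone h
    · exact cross ha hb
    · exact (cross hb ha).symm
    · exact (hs.total ha hb).imp (fun h => f'.monotone h) fun h => f'.monotone h
  · rw [← hn]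
    refine Set.ncard_lt_ncard ⟨fun a ha => ?_, fun hsub => hsub hp.1 hf'p⟩
    rcases eq_or_ne a p with rfl | hap
    · exact absurd hf'p ha
    · exact fun h => ha ((hf' a hap).trans h)

/-- The whole weight, which is one, lands on `q`. -/
theorem map_const_apply (q : Q) (w w' : PosetSpace P) :
    map (OrderHom.const P q) w = map (OrderHom.const P q) w' := by
  classical
  have := Fintype.ofFinite P
  apply Subtype.ext
  funext r
  change FunOnFinite.linearMap ℝ ℝ (fun _ => q) w.1 r =
    FunOnFinite.linearMap ℝ ℝ (fun _ => q) w'.1 r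
  have h1 := w.2.2.1
  have h2 := w'.2.2.1
  rw [finsum_eq_sum_of_fintype] at h1 h2
  rw [FunOnFinite.linearMap_apply_apply, FunOnFinite.linearMap_apply_apply]
  by_cases hr : q = r <;> simp [hr, h1, h2]

/-- The vertex of the realization corresponding to an element of the poset. -/
noncomputable def vertex (p : P) : PosetSpace P := by
  classical
  exact ⟨Pi.single p 1, orderComplex_realization_mem_iff.mpr
    ⟨fun q => by by_cases h : q = p <;> simp [h],
      by have := Fintype.ofFinite P; simp [finsum_eq_sum_of_fintype],
      (Set.subsingleton_singleton.anti Pi.support_single_subset).isChain⟩⟩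

theorem contractibleSpace_of_isLeast {p : P} (hp : ∀ q, p ≤ q) :
    ContractibleSpace (PosetSpace P) := by
  rw [contractible_iff_id_nullhomotopic]
  refine ⟨map (OrderHom.const P p) (vertex p), ?_⟩
  -- The constant map at the least element lies below the identity.
  have h : (map (OrderHom.const P p)).Homotopic (map OrderHom.id) := homotopic_map_of_le hp
  rw [map_id] at h
  convert h.symm using 1
  ext1 w
  exact map_const_apply ..

/-- A monotone map with a monotone retraction `r` satisfying `q ≤ i (r q)` induces a homotopy
equivalence. -/
theorem exists_homotopyEquiv {i : P →o Q} {r : Q →o P} (hri : r.comp i = OrderHom.id)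
    (hir : OrderHom.id ≤ i.comp r) :
    ∃ e : ContinuousMap.HomotopyEquiv (PosetSpace P) (PosetSpace Q), e.toFun = map i := by
  refine ⟨⟨map i, map r, ?_, ?_⟩, rfl⟩
  · rw [← map_comp, hri, map_id]
  · rw [← map_comp, ← map_id]
    exact (homotopic_map_of_le hir).symm

end PosetSpace

section
variable {X : Type*} [SemilatticeInf X]

theorem fixedAboveFibre_nonempty {g : X ≃o X} {x y : X} (hy : y ∈ lowerFixedAbove g x) :
    (fixedAboveFibre g x y).Nonempty := by
  obtain ⟨⟨z, hz, hyz⟩, hxy⟩ := hy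
  exact ⟨z, ⟨hz, hxy.trans_le hyz⟩, hyz⟩

theorem infClosed_fixedAboveFibre {g : X ≃o X} {x y : X} (hxy : x < y) :
    InfClosed (fixedAboveFibre g x y) := by
  rintro a ⟨⟨ha, -⟩, hya⟩ b ⟨⟨hb, -⟩, hyb⟩
  have h : y ≤ a ⊓ b := le_inf hya hyb
  exact ⟨⟨(map_inf g a b).trans (congrArg₂ _ ha hb), hxy.trans_le h⟩, h⟩

/-- A minimal `m` is least: `m ⊓ z` lies in `s` below `m`, so `m ≤ m ⊓ z ≤ z`. -/
theorem InfClosed.exists_isLeast {s : Set X} (hs : InfClosed s) (hfin : s.Finite)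
    (hne : s.Nonempty) : ∃ m, IsLeast s m := by
  obtain ⟨m, hm⟩ := hfin.exists_minimal hne
  exact ⟨m, hm.1, fun z hz => (hm.2 (hs hm.1 hz) inf_le_left).trans inf_le_right⟩

theorem exists_isLeast_fixedAboveFibre [Finite X] {g : X ≃o X} {x y : X}
    (hy : y ∈ lowerFixedAbove g x) : ∃ m, IsLeast (fixedAboveFibre g x y) m :=
  (infClosed_fixedAboveFibre hy.2).exists_isLeast (Set.toFinite _) (fixedAboveFibre_nonempty hy)

/-- The retraction sending `y` to the least fixed point above it. -/
noncomputable def fixedAboveRetraction [Finite X] (g : X ≃o X) (x : X) :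
    lowerFixedAbove g x →o fixedAbove g x where
  toFun y := ⟨(exists_isLeast_fixedAboveFibre y.2).choose,
    (exists_isLeast_fixedAboveFibre y.2).choose_spec.1.1⟩
  -- For `y ≤ z`, the fibre over `y` contains the fibre over `z`, so its least element is no larger.
  monotone' := fun y z hyz => (exists_isLeast_fixedAboveFibre y.2).choose_spec.2
    ⟨(exists_isLeast_fixedAboveFibre z.2).choose_spec.1.1,
      le_trans hyz (exists_isLeast_fixedAboveFibre z.2).choose_spec.1.2⟩

theorem isLeast_fixedAboveRetraction [Finite X] (g : X ≃o X) (x : X) (y : lowerFixedAbove g x) :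
    IsLeast (fixedAboveFibre g x y) (fixedAboveRetraction g x y : X) :=
  (exists_isLeast_fixedAboveFibre y.2).choose_spec

end

theorem mainTheorem12 {X : Type*} [SemilatticeInf X] [Finite X] (g : X ≃o X) (x : X) :
    (∃ e : ContinuousMap.HomotopyEquiv (PosetSpace (fixedAbove g x))
        (PosetSpace (lowerFixedAbove g x)),
      e.toFun = PosetSpace.map (fixedAboveIncl g x)) ∧
    ∀ y ∈ lowerFixedAbove g x,
      (fixedAboveFibre g x y).Nonempty ∧
      InfClosed (fixedAboveFibre g x y) ∧
      (∃ m, IsLeast (fixedAboveFibre g x y) m) ∧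
      ContractibleSpace (PosetSpace (fixedAboveFibre g x y)) := by
  refine ⟨PosetSpace.exists_homotopyEquiv (r := fixedAboveRetraction g x) ?_ ?_, fun y hy => ?_⟩
  · ext z : 2
    -- A fixed point is the least element of its own fibre.
    exact Subtype.ext
      ((isLeast_fixedAboveRetraction g x (fixedAboveIncl g x z)).unique
        ⟨⟨z.2, le_rfl⟩, fun _ h => h.2⟩)
  · exact fun y => (isLeast_fixedAboveRetraction g x y).1.2
  · obtain ⟨m, hm⟩ := exists_isLeast_fixedAboveFibre hy
    exact ⟨fixedAboveFibre_nonempty hy, infClosed_fixedAboveFibre hy.2, ⟨m, hm⟩,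
      PosetSpace.contractibleSpace_of_isLeast (p := ⟨m, hm.1⟩) fun q => hm.2 q.2⟩
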